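/- Let $\varphi : A \to B$ be a homomorphism of commutative Noetherian rings such that $B$ is a finitely generated $A$-module (via $\varphi$), let $\mathfrak a$ be an ideal of $A$, and let $X$ be a $B$-module. Write $\mathcal C(R)$ for the category of modules over a ring $R$. A Serre subcategory of $\mathcal C(R)$ is a class of $R$-modules that contains $0$ and is closed under taking submodules, quotients and extensions (and hence under isomorphism). For a commutative Noetherian ring $R$, an ideal $\mathfrak b$ of $R$ and a Serre subcategory $\mathcal U$ of $\mathcal C(R)$, an $R$-module $M$ is called $(\mathcal U, \mathfrak b)$-cofinite if $\operatorname{Supp}_R(M) \subseteq V(\mathfrak b)$ and $\operatorname{Ext}^i_R(R/\mathfrak b, M) \in \mathcal U$ for all $i \ge 0$. Let $\mathcal S$ and $\mathcal T$ be Serre subcategories of $\mathcal C(A)$ and $\mathcal C(B)$, respectively, such that for every $B$-module $Y$ one has $Y \in \mathcal T$ if and only if $Y$, regarded as an $A$-module via $\varphi$, belongs to $\mathcal S$. Then $X$ is $(\mathcal T, \mathfrak a B)$-cofinite if and only if $X$, regarded as an $A$-module via $\varphi$, is $(\mathcal S, \mathfrak a)$-cofinite. -/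

import Mathlib

universe u

open CategoryTheory

/-- For a commutative ring `R`, a class `S` of `R`-modules and an ideal `a` of `R`, an `R`-module
`X` is `(S, a)`-cofinite if `Supp_R X ⊆ V(a)` and the `R`-module `Ext^i_R(R ⧸ a, X)` belongs to
`S` for every `i ≥ 0`. Here `Ext` is the usual `Ext` in the abelian category of `R`-modules, with
the `R`-module structure coming from `R`-linearity of that category. -/
def IsSerreCofinite {R : Type u} [CommRing R] (S : ObjectProperty (ModuleCat.{u} R))
    (a : Ideal R) (X : ModuleCat.{u} R) : Prop :=
  Module.support R X ⊆ PrimeSpectrum.zeroLocus (a : Set R) ∧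
    ∀ i : ℕ, S (ModuleCat.of R (Abelian.Ext.{u} (ModuleCat.of R (R ⧸ a)) X i))

/-! The support conditions agree because both say that every element of `X` is torsion with respect
to each `s ∈ a`. The Ext conditions are compared by dimension shifting. Call an `A`-module `M` good
if each `s ∈ a` acts on it through a finite free module; `A ⧸ a` is good, and goodness passes to
syzygies. For a free cover `π` of a good `M`, the map from `B ⊗ ker π` onto `ker (B ⊗ π)` has kernel
`Tor₁(B, M)`, which is killed by `aB`. If `Ext^j_B(B ⧸ aB, X)` is in `T` for `j < i`, the same holds
for all finite modules killed by `aB` (`ext_of_le_annihilator`), so these kernels do not affect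
membership in `T`, and `ext_baseChange_iff` matches `Ext^i_A(A ⧸ a, X)` with `Ext^i_B(B ⧸ aB, X)`.
Induction on `i` concludes. -/

open Abelian LinearMap TensorProduct

/-! ### Serre classes in terms of linear maps. -/

section SerreClass

variable {R : Type u} [CommRing R] (S : ObjectProperty (ModuleCat.{u} R)) [S.IsSerreClass]
variable {M N P : Type u} [AddCommGroup M] [Module R M] [AddCommGroup N] [Module R N]
  [AddCommGroup P] [Module R P]

namespace CategoryTheory.ObjectProperty

lemma of_exact (f : M →ₗ[R] N) (g : N →ₗ[R] P) (h : Function.Exact f g)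
    (hM : S (ModuleCat.of R M)) (hP : S (ModuleCat.of R P)) : S (ModuleCat.of R N) :=
  S.prop_X₂_of_exact (S := ModuleCat.shortComplexOfCompEqZero f g h.linearMap_comp_eq_zero)
    (ModuleCat.shortComplex_exact _ h) hM hP

lemma of_injective (f : M →ₗ[R] N) (h : Function.Injective f)
    (hN : S (ModuleCat.of R N)) : S (ModuleCat.of R M) :=
  have : Mono (ModuleCat.ofHom f) := (ModuleCat.mono_iff_injective _).mpr h
  S.prop_of_mono (ModuleCat.ofHom f) hN

lemma of_surjective (f : M →ₗ[R] N) (h : Function.Surjective f)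
    (hM : S (ModuleCat.of R M)) : S (ModuleCat.of R N) :=
  have : Epi (ModuleCat.ofHom f) := (ModuleCat.epi_iff_surjective _).mpr h
  S.prop_of_epi (ModuleCat.ofHom f) hM

lemma linearEquiv_iff (e : M ≃ₗ[R] N) : S (ModuleCat.of R M) ↔ S (ModuleCat.of R N) :=
  ⟨S.of_surjective e.toLinearMap e.surjective, S.of_injective e.toLinearMap e.injective⟩

lemma of_subsingleton [Subsingleton M] : S (ModuleCat.of R M) := by
  obtain ⟨Z, hZ, hS⟩ := ContainsZero.exists_zero (P := S)
  exact S.of_injective (N := Z) 0 (Function.injective_of_subsingleton _) hS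

end CategoryTheory.ObjectProperty

end SerreClass

/-! ### Long exact Ext sequences modulo a Serre class. -/

section ExtSequence

variable {R : Type u} [CommRing R] (S : ObjectProperty (ModuleCat.{u} R)) [S.IsSerreClass]
variable {M N : Type u} [AddCommGroup M] [Module R M] [AddCommGroup N] [Module R N]
variable (X : ModuleCat.{u} R)

/-- The Ext modules `Ext^i_R(M, X)`. -/
noncomputable abbrev ModuleCat.ExtModule (M : Type u) [AddCommGroup M] [Module R M] (X : ModuleCat.{u} R)
    (i : ℕ) : ModuleCat.{u} R :=
  ModuleCat.of R (Ext.{u} (ModuleCat.of R M) X i)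

namespace CategoryTheory.ObjectProperty

open ModuleCat

lemma ext_congr (e : M ≃ₗ[R] N) {i : ℕ} (h : S (ExtModule N X i)) : S (ExtModule M X i) := by
  refine S.of_surjective (Ext.precompOfLinear (Ext.mk₀ (ModuleCat.ofHom e.toLinearMap)) R X
    (zero_add i)) (fun x ↦ ⟨(Ext.mk₀ (ModuleCat.ofHom e.symm.toLinearMap)).comp x
      (zero_add i), ?_⟩) h
  have : ModuleCat.ofHom e.toLinearMap ≫ ModuleCat.ofHom e.symm.toLinearMap =
      𝟙 (ModuleCat.of R M) := by
    ext; simp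
  simp [this]

lemma ext_of_subsingleton [Subsingleton M] (i : ℕ) : S (ExtModule M X i) := by
  have : Subsingleton (Ext.{u} (ModuleCat.of R M) X i) := by
    refine subsingleton_of_forall_eq 0 fun x ↦ ?_
    have : 𝟙 (ModuleCat.of R M) = 0 := by
      ext y; exact Subsingleton.elim (α := M) _ _
    rw [← Ext.mk₀_id_comp x, this]
    simp
  exact S.of_subsingleton

variable {f : M →ₗ[R] N} (hf : Function.Surjective f)
include hf

lemma ext_mid {i : ℕ} (h₁ : S (ExtModule (ker f) X i)) (h₃ : S (ExtModule N X i)) :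
    S (ExtModule M X i) := by
  have hS := shortExact_shortComplexKer hf
  refine S.of_exact (Ext.precompOfLinear (Ext.mk₀ (ModuleCat.ofHom f)) R X (zero_add i))
    (Ext.precompOfLinear (Ext.mk₀ (ModuleCat.ofHom (ker f).subtype)) R X (zero_add i))
    (fun x ↦ ⟨fun hx ↦ ?_, ?_⟩) h₃ h₁
  · exact Ext.contravariant_sequence_exact₂ hS X x hx
  · rintro ⟨y, rfl⟩
    have := f.shortComplexKer.zero
    simp at this
    simp [this]

lemma ext_right {i j : ℕ} (hij : 1 + i = j) (h₁ : S (ExtModule (ker f) X i))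
    (h₂ : S (ExtModule M X j)) : S (ExtModule N X j) := by
  have hS := shortExact_shortComplexKer hf
  refine S.of_exact (Ext.precompOfLinear hS.extClass R X hij)
    (Ext.precompOfLinear (Ext.mk₀ (ModuleCat.ofHom f)) R X (zero_add j))
    (fun x ↦ ⟨fun hx ↦ ?_, ?_⟩) h₁ h₂
  · exact Ext.contravariant_sequence_exact₃ hS X x hx hij
  · rintro ⟨y, rfl⟩
    exact hS.comp_extClass_assoc y hij

lemma ext_left {i j : ℕ} (hij : 1 + i = j) (h₂ : S (ExtModule M X i))
    (h₃ : S (ExtModule N X j)) : S (ExtModule (ker f) X i) := by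
  have hS := shortExact_shortComplexKer hf
  refine S.of_exact
    (Ext.precompOfLinear (Ext.mk₀ (ModuleCat.ofHom (ker f).subtype)) R X (zero_add i))
    (Ext.precompOfLinear hS.extClass R X hij) (fun x ↦ ⟨fun hx ↦ ?_, ?_⟩) h₂ h₃
  · exact Ext.contravariant_sequence_exact₁ hS X x hij hx
  · rintro ⟨y, rfl⟩
    exact hS.extClass_comp_assoc y (h := hij)

lemma ext_zero_right (h₂ : S (ExtModule M X 0)) : S (ExtModule N X 0) := by
  have hS := shortExact_shortComplexKer hf
  have := hS.epi_g
  exact S.of_injective (Ext.precompOfLinear (Ext.mk₀ (ModuleCat.ofHom f)) R X (zero_add 0))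
    (Ext.precomp_mk₀_injective_of_epi X (ModuleCat.ofHom f)) h₂

/-- The shift starts at degree 2: one degree lower it would involve `Ext^0(M, X)`, which need not
vanish. -/
lemma ext_succ_iff [Module.Projective R M] (i : ℕ) :
    S (ExtModule N X (i + 2)) ↔ S (ExtModule (ker f) X (i + 1)) := by
  have hP (j : ℕ) : S (ExtModule M X (j + 1)) := by
    have := ModuleCat.projective_of_module_projective (ModuleCat.of R M)
    have := Ext.subsingleton_of_projective (ModuleCat.of R M) X j
    exact S.of_subsingleton
  exact ⟨S.ext_left X hf (by lia) (hP i), fun h ↦ S.ext_right X hf (by lia) h (hP (i + 1))⟩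

end CategoryTheory.ObjectProperty

/-- For a surjection `f` from a projective module, `Ext^1` of the target is a quotient of the
module of maps from the kernel of `f`, by those maps that extend. -/
lemma LinearMap.exists_connecting_hom [Module.Projective R M] {f : M →ₗ[R] N}
    (hf : Function.Surjective f) :
    ∃ δ : (ker f →ₗ[R] X) →ₗ[R] Ext.{u} (ModuleCat.of R N) X 1, Function.Surjective δ ∧
      ∀ v, δ v = 0 ↔ ∃ w : M →ₗ[R] X, w ∘ₗ (ker f).subtype = v := by
  have hS := shortExact_shortComplexKer hf
  let e (L : Type u) [AddCommGroup L] [Module R L] :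
      Ext.{u} (ModuleCat.of R L) X 0 ≃ₗ[R] (L →ₗ[R] X) :=
    (Ext.linearEquiv₀ (R := R)).trans (ModuleCat.homLinearEquiv (S := R))
  have he (L : Type u) [AddCommGroup L] [Module R L] (v : L →ₗ[R] X) :
      (e L).symm v = Ext.mk₀ (ModuleCat.ofHom v) := rfl
  have := ModuleCat.projective_of_module_projective (ModuleCat.of R M)
  refine ⟨(Ext.precompOfLinear hS.extClass R X (add_zero 1)) ∘ₗ (e (ker f)).symm.toLinearMap,
    ?_, fun v ↦ ⟨fun hv ↦ ?_, ?_⟩⟩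
  · exact (precomp_extClass_surjective_of_projective_X₂ X hS 0).comp (e (ker f)).symm.surjective
  · obtain ⟨x, hx⟩ := Ext.contravariant_sequence_exact₁ hS X ((e (ker f)).symm v) (add_zero 1) hv
    obtain ⟨w, rfl⟩ := (e M).symm.surjective x
    refine ⟨w, (e (ker f)).symm.injective ?_⟩
    rw [← hx, he, he]
    simp
  · rintro ⟨w, rfl⟩
    have : (e (ker f)).symm (w ∘ₗ (ker f).subtype) =
        (Ext.mk₀ f.shortComplexKer.f).comp ((e M).symm w) (zero_add 0) := by
      rw [he, he]
      simp
    simp only [coe_comp, Function.comp_apply, LinearEquiv.coe_coe, this]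
    exact hS.extClass_comp_assoc _ (h := add_zero 1)

end ExtSequence

/-! ### Finite modules killed by an ideal. -/

section Annihilated

lemma Module.Finite.exists_fin_quotient {R : Type*} [CommRing R] {b : Ideal R} {N : Type*}
    [AddCommGroup N] [Module R N] [Module.Finite R N] (hN : b ≤ Module.annihilator R N) :
    ∃ (n : ℕ) (f : (Fin n → R ⧸ b) →ₗ[R] N), Function.Surjective f := by
  have hN' : Module.IsTorsionBySet R N b := fun x r ↦ Module.mem_annihilator.mp (hN r.2) x
  let := hN'.module
  have : IsScalarTower R (R ⧸ b) N := hN'.isScalarTower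
  have := Module.Finite.of_restrictScalars_finite R (R ⧸ b) N
  obtain ⟨n, f, hf⟩ := Module.Finite.exists_fin' (R ⧸ b) N
  exact ⟨n, f.restrictScalars R, hf⟩

variable {R : Type u} [CommRing R] (S : ObjectProperty (ModuleCat.{u} R)) [S.IsSerreClass] (X : ModuleCat.{u} R)

namespace CategoryTheory.ObjectProperty

open ModuleCat

lemma ext_pi_fin {M : Type u} [AddCommGroup M] [Module R M] {i : ℕ}
    (h : S (ExtModule M X i)) (n : ℕ) : S (ExtModule (Fin n → M) X i) := by
  induction n with
  | zero => exact S.ext_of_subsingleton X i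
  | succ n ih =>
    have hsurj : Function.Surjective (LinearMap.proj (R := R) (φ := fun _ : Fin (n + 1) ↦ M) 0) :=
      LinearMap.proj_surjective 0
    refine S.ext_mid X hsurj (S.ext_congr X ?_ ih) h
    exact
      { toFun x := Fin.tail x.1
        invFun y := ⟨Fin.cons 0 y, by simp⟩
        left_inv x := by
          have hx : x.1 0 = 0 := x.2
          ext k
          refine Fin.cases ?_ (fun k ↦ ?_) k <;> simp [Fin.tail, hx]
        right_inv y := by simp
        map_add' _ _ := rfl
        map_smul' _ _ := rfl }

/-- If `Ext^j(R ⧸ b, X)` lies in a Serre class for `j ≤ i`, then so does `Ext^i(N, X)` for every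
finitely generated module `N` annihilated by `b`. -/
lemma ext_of_le_annihilator [IsNoetherianRing R] {b : Ideal R} {i : ℕ}
    (h : ∀ j ≤ i, S (ExtModule (R ⧸ b) X j))
    (N : Type u) [AddCommGroup N] [Module R N] [Module.Finite R N]
    (hN : b ≤ Module.annihilator R N) : S (ExtModule N X i) := by
  obtain ⟨n, f, hf⟩ := Module.Finite.exists_fin_quotient hN
  induction i generalizing N n with
  | zero => exact S.ext_zero_right X hf (S.ext_pi_fin X (h 0 le_rfl) n)
  | succ i ih =>
    have hK : b ≤ Module.annihilator R (ker f) := fun r hr ↦ by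
      refine Module.mem_annihilator.mpr fun x ↦ Subtype.ext (funext fun k ↦ ?_)
      obtain ⟨y, hy⟩ := Ideal.Quotient.mk_surjective (x.1 k)
      change r • x.1 k = 0
      rw [← hy, Algebra.smul_def, Ideal.Quotient.algebraMap_eq, ← map_mul,
        Ideal.Quotient.eq_zero_iff_mem]
      exact b.mul_mem_right y hr
    -- The kernel is again finite and killed by `b`, so it falls under the induction one degree
    -- lower.
    refine S.ext_right X hf (add_comm 1 i) ?_ (S.ext_pi_fin X (h _ le_rfl) n)
    obtain ⟨m, g, hg⟩ := Module.Finite.exists_fin_quotient hK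
    exact ih (fun j hj ↦ h j (by lia)) (ker f) hK m g hg

end CategoryTheory.ObjectProperty

end Annihilated

/-! ### Modules on which an element acts through a free module. -/

section StablyZero

/-- Multiplication by `s` on `M` factors through a finite free module. -/
def Module.SMulFactorsThroughFree {A : Type*} [CommRing A] (s : A) (M : Type*) [AddCommGroup M]
    [Module A M] : Prop :=
  ∃ (n : ℕ) (f : M →ₗ[A] (Fin n → A)) (g : (Fin n → A) →ₗ[A] M), ∀ x, g (f x) = s • x

variable {A : Type*} [CommRing A] {s : A} {M P : Type*} [AddCommGroup M] [Module A M]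
  [AddCommGroup P] [Module A P]

lemma Module.SMulFactorsThroughFree.exists_extension (h : Module.SMulFactorsThroughFree s M)
    {π : P →ₗ[A] M} (hπ : Function.Surjective π) :
    ∃ r : P →ₗ[A] ker π, ∀ x : ker π, r x = s • x := by
  obtain ⟨n, f, g, hfg⟩ := h
  obtain ⟨g', hg'⟩ := Module.projective_lifting_property π g hπ
  have hg (y) : π (g' y) = g y := LinearMap.congr_fun hg' y
  -- The correction term lifts `s • π` to `P` and vanishes on `ker π`.
  refine ⟨(s • LinearMap.id - g' ∘ₗ f ∘ₗ π).codRestrict (ker π) fun x ↦ ?_, fun x ↦ ?_⟩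
  · exact Subtype.ext (by simp)
  · simp [hg, hfg]

lemma Module.SMulFactorsThroughFree.ker {n : ℕ} (h : Module.SMulFactorsThroughFree s M)
    {π : (Fin n → A) →ₗ[A] M} (hπ : Function.Surjective π) :
    Module.SMulFactorsThroughFree s (LinearMap.ker π) := by
  obtain ⟨r, hr⟩ := h.exists_extension hπ
  exact ⟨n, (LinearMap.ker π).subtype, r, hr⟩

lemma Module.SMulFactorsThroughFree.quotient {a : Ideal A} (hs : s ∈ a) :
    Module.SMulFactorsThroughFree s (A ⧸ a) := by
  refine ⟨0, 0, 0, fun x ↦ ?_⟩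
  obtain ⟨y, rfl⟩ := Ideal.Quotient.mk_surjective x
  rw [Algebra.smul_def, Ideal.Quotient.algebraMap_eq, ← map_mul, LinearMap.zero_apply, eq_comm,
    Ideal.Quotient.eq_zero_iff_mem]
  exact a.mul_mem_right y hs

end StablyZero

/-! ### Base change of syzygies. -/

section BaseChangeKernel

variable {A : Type*} (B : Type*) [CommRing A] [CommRing B] [Algebra A B]
  {M P : Type*} [AddCommGroup M] [Module A M] [AddCommGroup P] [Module A P]

/-- The comparison map from the base change of a kernel to the kernel of the base change. -/
noncomputable def LinearMap.baseChangeKer (π : P →ₗ[A] M) :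
    B ⊗[A] ker π →ₗ[B] ker (π.baseChange B) :=
  ((ker π).subtype.baseChange B).codRestrict _ fun x ↦ by
    rw [mem_ker, ← LinearMap.comp_apply, ← baseChange_comp, comp_ker_subtype, baseChange_zero,
      LinearMap.zero_apply]

@[simp]
lemma LinearMap.subtype_baseChangeKer (π : P →ₗ[A] M) (x : B ⊗[A] ker π) :
    (baseChangeKer B π x : B ⊗[A] P) = (ker π).subtype.baseChange B x := rfl

lemma LinearMap.baseChangeKer_surjective {π : P →ₗ[A] M} (hπ : Function.Surjective π) :
    Function.Surjective (baseChangeKer B π) := by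
  rintro ⟨x, hx⟩
  have hex : Function.Exact (ker π).subtype π := π.exact_subtype_ker_map
  obtain ⟨y, hy⟩ := (lTensor_exact B hex hπ x).mp hx
  exact ⟨y, Subtype.ext hy⟩

/-- Multiplication by `s` on `ker π` factors through the inclusion into `P`. After base change it
therefore kills whatever that inclusion kills. -/
lemma LinearMap.map_le_annihilator_ker_baseChangeKer {a : Ideal A}
    (hM : ∀ s ∈ a, Module.SMulFactorsThroughFree s M) {π : P →ₗ[A] M}
    (hπ : Function.Surjective π) :
    a.map (algebraMap A B) ≤ Module.annihilator B (ker (baseChangeKer B π)) := by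
  refine Ideal.map_le_iff_le_comap.mpr fun s hs ↦ ?_
  obtain ⟨r, hr⟩ := (hM s hs).exists_extension hπ
  refine Module.mem_annihilator.mpr fun x ↦ Subtype.ext ?_
  have hx : (ker π).subtype.baseChange B x = 0 := congrArg Subtype.val x.2
  have hr' : r ∘ₗ (ker π).subtype = s • LinearMap.id := LinearMap.ext hr
  have := congrArg (fun g ↦ g.baseChange B x.1) hr'
  simpa [baseChange_comp, hx, eq_comm] using this

end BaseChangeKernel

/-! ### Comparison over `A` and `B` in degree one. -/

section Comparison

variable {A B : Type u} [CommRing A] [CommRing B] [Algebra A B]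
  (S : ObjectProperty (ModuleCat.{u} A)) (T : ObjectProperty (ModuleCat.{u} B))

namespace CategoryTheory.ObjectProperty

open ModuleCat

variable {S T} in
lemma restrictScalars_iff [S.IsSerreClass]
    (hST : ∀ Y : ModuleCat.{u} B, T Y ↔ S ((ModuleCat.restrictScalars.{u} (algebraMap A B)).obj Y))
    (Y : Type u) [AddCommGroup Y] [Module A Y] [Module B Y] [IsScalarTower A B Y] :
    T (ModuleCat.of B Y) ↔ S (ModuleCat.of A Y) := by
  rw [hST]
  exact S.linearEquiv_iff (M := (ModuleCat.restrictScalars.{u} (algebraMap A B)).obj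
    (ModuleCat.of B Y))
    { toFun x := x
      invFun x := x
      left_inv _ := rfl
      right_inv _ := rfl
      map_add' _ _ := rfl
      map_smul' r x := algebraMap_smul (M := Y) B r x }

/-- Comparison of the cokernels `EI` and `EN` of maps with the same source into `HI ⊆ HN`. -/
lemma iff_of_exact_of_ker_eq [S.IsSerreClass] {HI HN HT EI EN : Type u} [AddCommGroup HI] [Module A HI]
    [AddCommGroup HN] [Module A HN] [AddCommGroup HT] [Module A HT] [AddCommGroup EI] [Module A EI]
    [AddCommGroup EN] [Module A EN] {j : HI →ₗ[A] HN} {t : HN →ₗ[A] HT}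
    (hjt : Function.Exact j t) {δI : HI →ₗ[A] EI} {δN : HN →ₗ[A] EN}
    (hδI : Function.Surjective δI) (hδN : Function.Surjective δN)
    (hker : ∀ v, δI v = 0 ↔ δN (j v) = 0) (hker' : ∀ v, δN v = 0 → t v = 0)
    (hHT : S (ModuleCat.of A HT)) : S (ModuleCat.of A EN) ↔ S (ModuleCat.of A EI) := by
  let eI := δI.quotKerEquivOfSurjective hδI
  let eN := δN.quotKerEquivOfSurjective hδN
  have heI (v) : eI ((ker δI).mkQ v) = δI v := rfl
  have heN (v) : eN ((ker δN).mkQ v) = δN v := rfl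
  let ψ : EI →ₗ[A] EN :=
    (ker δI).liftQ (δN ∘ₗ j) (fun v hv ↦ (hker v).mp hv) ∘ₗ eI.symm.toLinearMap
  have hψ (v) : ψ (δI v) = δN (j v) := by
    simp only [ψ, ← heI, coe_comp, LinearEquiv.coe_coe, Function.comp_apply, eI.symm_apply_apply]
    rfl
  let τ : EN →ₗ[A] HT := (ker δN).liftQ t (fun v hv ↦ hker' v hv) ∘ₗ eN.symm.toLinearMap
  have hτ (v) : τ (δN v) = t v := by
    simp only [τ, ← heN, coe_comp, LinearEquiv.coe_coe, Function.comp_apply, eN.symm_apply_apply]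
    rfl
  refine ⟨S.of_injective ψ ((injective_iff_map_eq_zero ψ).mpr fun x hx ↦ ?_),
    fun h ↦ S.of_exact ψ τ (fun x ↦ ?_) h hHT⟩
  · obtain ⟨v, rfl⟩ := hδI x
    rw [hψ] at hx
    exact (hker v).mpr hx
  · obtain ⟨v, rfl⟩ := hδN x
    rw [hτ, hjt v]
    constructor
    · rintro ⟨w, rfl⟩
      exact ⟨δI w, hψ w⟩
    · rintro ⟨y, hy⟩
      obtain ⟨w, rfl⟩ := hδI y
      rw [hψ, ← sub_eq_zero, ← map_sub] at hy
      have := hker' _ hy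
      rw [map_sub, (hjt (j w)).mpr ⟨w, rfl⟩, zero_sub, neg_eq_zero] at this
      exact (hjt v).mp this

-- Each `Ext^1` is the cokernel of restricting maps from the cover to its kernel. The two
-- restriction maps have the same source by adjunction, and their targets differ only by a submodule
-- of `Hom_B(K, X)`, where `K` is the kernel of `baseChangeKer`.
variable {S T} in
lemma ext_one_baseChange_iff [S.IsSerreClass] [T.IsSerreClass]
    (hST : ∀ Y : ModuleCat.{u} B, T Y ↔ S ((ModuleCat.restrictScalars.{u} (algebraMap A B)).obj Y))
    (X : Type u) [AddCommGroup X] [Module A X] [Module B X] [IsScalarTower A B X]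
    {M P : Type u} [AddCommGroup M] [Module A M] [AddCommGroup P] [Module A P]
    [Module.Projective A P] {π : P →ₗ[A] M} (hπ : Function.Surjective π)
    (hT : T (ExtModule (ker (baseChangeKer B π)) (ModuleCat.of B X) 0)) :
    S (ExtModule M (ModuleCat.of A X) 1) ↔
      T (ExtModule (B ⊗[A] M) (ModuleCat.of B X) 1) := by
  obtain ⟨δA, hδA, hkA⟩ := LinearMap.exists_connecting_hom (ModuleCat.of A X) hπ
  have hπB : Function.Surjective (π.baseChange B) := lTensor_surjective B hπ
  obtain ⟨δB, hδB, hkB⟩ := LinearMap.exists_connecting_hom (ModuleCat.of B X) hπB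
  let := Module.compHom
    (Ext.{u} (ModuleCat.of B (B ⊗[A] M)) (ModuleCat.of B X) 1) (algebraMap A B)
  have : IsScalarTower A B (Ext.{u} (ModuleCat.of B (B ⊗[A] M)) (ModuleCat.of B X) 1) :=
    .of_algebraMap_smul fun _ _ ↦ rfl
  rw [restrictScalars_iff hST]
  let K := ker (baseChangeKer B π)
  have hq := baseChangeKer_surjective B hπ
  let ε : (ker π →ₗ[A] X) ≃ₗ[A] (B ⊗[A] ker π →ₗ[B] X) :=
    (liftBaseChangeEquiv B).restrictScalars A
  let j : (ker (π.baseChange B) →ₗ[B] X) →ₗ[A] (ker π →ₗ[A] X) :=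
    ε.symm.toLinearMap ∘ₗ (lcomp B X (baseChangeKer B π)).restrictScalars A
  let t : (ker π →ₗ[A] X) →ₗ[A] (K →ₗ[B] X) :=
    (lcomp B X K.subtype).restrictScalars A ∘ₗ ε.toLinearMap
  have hj_apply (w) : j w = ε.symm (lcomp B X (baseChangeKer B π) w) := rfl
  have ht_apply (v) : t v = lcomp B X K.subtype (ε v) := rfl
  have hHT : S (ModuleCat.of A (K →ₗ[B] X)) := by
    rw [← restrictScalars_iff hST]
    exact (T.linearEquiv_iff ((Ext.linearEquiv₀ (R := B)).trans
      (ModuleCat.homLinearEquiv (S := B)))).mp hT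
  have hres (w : B ⊗[A] P →ₗ[B] X) : j (w ∘ₗ (ker (π.baseChange B)).subtype) =
      (liftBaseChangeEquiv B).symm w ∘ₗ (ker π).subtype := by
    ext x
    simp [j, ε]
  have hj : Function.Injective j := by
    intro v w h
    have := ε.symm.injective h
    exact (LinearMap.cancel_right hq).mp this
  have hjt : Function.Exact j t := by
    have hK : Function.Exact K.subtype (baseChangeKer B π) :=
      fun x ↦ ⟨fun hx ↦ ⟨⟨x, hx⟩, rfl⟩, fun ⟨y, hy⟩ ↦ hy ▸ y.2⟩
    have hex := exact_lcomp_of_exact_of_surjective (R := B) (M1 := K) (M2 := B ⊗[A] ker π)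
      (M3 := ker (π.baseChange B)) X (f := K.subtype) (g := baseChangeKer B π) hK hq
    refine fun v ↦ ⟨fun hv ↦ ?_, ?_⟩
    · obtain ⟨w, hw⟩ := (hex (ε v)).mp hv
      exact ⟨w, by rw [hj_apply, hw, ε.symm_apply_apply]⟩
    · rintro ⟨w, rfl⟩
      rw [ht_apply, hj_apply, ε.apply_symm_apply]
      exact (hex _).mpr ⟨w, rfl⟩
  refine S.iff_of_exact_of_ker_eq (j := j) (t := t) hjt (δI := δB.restrictScalars A) hδB hδA
    (fun v ↦ ?_) (fun v hv ↦ ?_) hHT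
  · rw [hkA, restrictScalars_apply, hkB]
    constructor
    · rintro ⟨w, rfl⟩
      exact ⟨_, (hres w).symm⟩
    · rintro ⟨w, hw⟩
      -- The adjoint of an `A`-linear extension is a `B`-linear one, since `j` is injective.
      refine ⟨liftBaseChangeEquiv B w, hj ?_⟩
      rw [hres, LinearEquiv.symm_apply_apply, hw]
  · obtain ⟨w, rfl⟩ := (hkA v).mp hv
    rw [← (liftBaseChangeEquiv B).symm_apply_apply w, ← hres]
    exact (hjt _).mpr ⟨_, rfl⟩

end CategoryTheory.ObjectProperty

end Comparison

/-! ### Change of rings in all degrees, and supports. -/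

section ChangeOfRings

variable {A B : Type u} [CommRing A] [CommRing B] [Algebra A B]
  {S : ObjectProperty (ModuleCat.{u} A)} {T : ObjectProperty (ModuleCat.{u} B)}
  [S.IsSerreClass] [T.IsSerreClass]

namespace CategoryTheory.ObjectProperty

open ModuleCat

/-- Let `M` be a finitely generated `A`-module on which every `s ∈ a` acts through a free module.
If `Ext^j_B(K, X)` is in `T` for all `j < i` and all finitely generated `K` killed by `aB`, then
`Ext^i_A(M, X)` is in `S` if and only if `Ext^i_B(B ⊗ M, X)` is in `T`. -/
lemma ext_baseChange_iff [IsNoetherianRing A] [IsNoetherianRing B]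
    (hST : ∀ Y : ModuleCat.{u} B, T Y ↔ S ((ModuleCat.restrictScalars.{u} (algebraMap A B)).obj Y))
    (X : Type u) [AddCommGroup X] [Module A X] [Module B X] [IsScalarTower A B X] {a : Ideal A}
    {i : ℕ}
    (hX : ∀ j < i, ∀ (K : Type u) [AddCommGroup K] [Module B K] [Module.Finite B K],
      a.map (algebraMap A B) ≤ Module.annihilator B K → T (ExtModule K (ModuleCat.of B X) j))
    (M : Type u) [AddCommGroup M] [Module A M] [Module.Finite A M]
    (hM : ∀ s ∈ a, Module.SMulFactorsThroughFree s M) :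
    S (ExtModule M (ModuleCat.of A X) i) ↔ T (ExtModule (B ⊗[A] M) (ModuleCat.of B X) i) := by
  obtain ⟨n, π, hπ⟩ := Module.Finite.exists_fin' A M
  have hπB : Function.Surjective (π.baseChange B) := lTensor_surjective B hπ
  have hq := baseChangeKer_surjective B hπ
  have hK (j : ℕ) (hj : j < i) : T (ExtModule (ker (baseChangeKer B π)) (ModuleCat.of B X) j) :=
    hX j hj _ (map_le_annihilator_ker_baseChangeKer B hM hπ)
  induction i generalizing M n with
  | zero =>
    rw [S.linearEquiv_iff ((Ext.linearEquiv₀ (R := A)).trans (ModuleCat.homLinearEquiv (S := A))),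
      T.linearEquiv_iff ((Ext.linearEquiv₀ (R := B)).trans (ModuleCat.homLinearEquiv (S := B)))]
    refine Iff.trans ?_ (restrictScalars_iff hST (B ⊗[A] M →ₗ[B] X)).symm
    exact S.linearEquiv_iff ((liftBaseChangeEquiv B).restrictScalars A)
  | succ i ih =>
    obtain _ | i := i
    · exact ext_one_baseChange_iff hST X hπ (hK 0 one_pos)
    obtain ⟨m, ρ, hρ⟩ := Module.Finite.exists_fin' A (ker π)
    have hN : ∀ s ∈ a, Module.SMulFactorsThroughFree s (ker π) := fun s hs ↦ (hM s hs).ker hπ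
    have := ih (fun j hj ↦ hX j (by lia)) (ker π) hN m ρ hρ (lTensor_surjective B hρ)
      (baseChangeKer_surjective B hρ)
      (fun j hj ↦ hX j (by lia) _ (map_le_annihilator_ker_baseChangeKer B hN hρ))
    refine (S.ext_succ_iff _ hπ i).trans (this.trans (Iff.trans ?_ (T.ext_succ_iff _ hπB i).symm))
    -- One direction uses `Ext^i` of the kernel, the other `Ext^(i+1)`; both lie below the current
    -- degree `i + 2`.
    exact ⟨fun h ↦ T.ext_right (M := B ⊗[A] ker π) (N := ker (π.baseChange B)) _ hq (add_comm 1 i) (hK i (by lia)) h,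
      fun h ↦ T.ext_mid (M := B ⊗[A] ker π) (N := ker (π.baseChange B)) _ hq (hK (i + 1) (by lia)) h⟩

lemma ext_quotient_iff [IsNoetherianRing A] [IsNoetherianRing B]
    (hST : ∀ Y : ModuleCat.{u} B, T Y ↔ S ((ModuleCat.restrictScalars.{u} (algebraMap A B)).obj Y))
    (X : Type u) [AddCommGroup X] [Module A X] [Module B X] [IsScalarTower A B X] (a : Ideal A) :
    (∀ i, T (ExtModule (B ⧸ a.map (algebraMap A B)) (ModuleCat.of B X) i)) ↔
      ∀ i, S (ExtModule (A ⧸ a) (ModuleCat.of A X) i) := by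
  let e : (B ⧸ a.map (algebraMap A B)) ≃ₗ[B] B ⊗[A] (A ⧸ a) :=
    (Algebra.TensorProduct.quotIdealMapEquivTensorQuot B a).toLinearEquiv
  have key (i : ℕ) (h : ∀ j < i, T (ExtModule (B ⧸ a.map (algebraMap A B)) (ModuleCat.of B X) j)) :
      S (ExtModule (A ⧸ a) (ModuleCat.of A X) i) ↔
        T (ExtModule (B ⧸ a.map (algebraMap A B)) (ModuleCat.of B X) i) := by
    rw [ext_baseChange_iff hST X (a := a) (fun j hj K _ _ _ hK ↦
      T.ext_of_le_annihilator _ (fun k hk ↦ h k (by lia)) K hK) (A ⧸ a)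
      (fun s hs ↦ Module.SMulFactorsThroughFree.quotient hs)]
    exact ⟨T.ext_congr _ e, T.ext_congr _ e.symm⟩
  refine ⟨fun h i ↦ (key i fun j _ ↦ h j).mpr (h i), fun h i ↦ ?_⟩
  induction i using Nat.strong_induction_on with
  | _ i ih => exact (key i ih).mp (h i)

end CategoryTheory.ObjectProperty

lemma Module.support_subset_zeroLocus_iff {R M : Type*} [CommRing R] [AddCommGroup M] [Module R M]
    {a : Ideal R} : Module.support R M ⊆ PrimeSpectrum.zeroLocus (a : Set R) ↔
      ∀ s ∈ a, ∀ x : M, ∃ n : ℕ, s ^ n • x = 0 := by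
  have h (x : M) : a ≤ (Ideal.torsionOf R M x).radical ↔ ∀ s ∈ a, ∃ n : ℕ, s ^ n • x = 0 := by
    simp [SetLike.le_def, Ideal.mem_radical_iff, Ideal.mem_torsionOf_iff]
  have h' : (∀ s ∈ a, ∀ x : M, ∃ n : ℕ, s ^ n • x = 0) ↔
      ∀ x : M, a ≤ (Ideal.torsionOf R M x).radical := by
    simp only [h]
    exact ⟨fun H x s hs ↦ H s hs x, fun H s hs x ↦ H x s hs⟩
  rw [h']
  constructor
  · intro H x
    rw [Ideal.radical_eq_sInf]
    refine le_sInf fun p ⟨hp, hprime⟩ ↦ ?_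
    refine H (a := ⟨p, hprime⟩) (Module.mem_support_iff_exists_annihilator.mpr ⟨x, ?_⟩)
    exact fun r hr ↦ hp ((Submodule.mem_annihilator_span_singleton x r).mp hr)
  · intro H p hp
    obtain ⟨x, hx⟩ := Module.mem_support_iff_exists_annihilator.mp hp
    refine (H x).trans (p.2.radical_le_iff.mpr fun r hr ↦ hx ?_)
    exact (Submodule.mem_annihilator_span_singleton x r).mpr hr

/-- The elements of `B` with a power killing `x` form a radical ideal, so testing the generators
from `a` suffices. -/
lemma Module.support_subset_zeroLocus_map_iff (X : Type*) [AddCommGroup X] [Module A X]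
    [Module B X] [IsScalarTower A B X] {a : Ideal A} :
    Module.support B X ⊆ PrimeSpectrum.zeroLocus (a.map (algebraMap A B) : Set B) ↔
      Module.support A X ⊆ PrimeSpectrum.zeroLocus (a : Set A) := by
  simp only [support_subset_zeroLocus_iff]
  refine ⟨fun h s hs x ↦ ?_, fun h b hb x ↦ ?_⟩
  · obtain ⟨n, hn⟩ := h _ (Ideal.mem_map_of_mem _ hs) x
    exact ⟨n, by rwa [← map_pow, algebraMap_smul] at hn⟩
  · have : a.map (algebraMap A B) ≤ (Ideal.torsionOf B X x).radical := by
      refine Ideal.map_le_iff_le_comap.mpr fun s hs ↦ ?_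
      obtain ⟨n, hn⟩ := h s hs x
      exact ⟨n, by rwa [← map_pow, Ideal.mem_torsionOf_iff, algebraMap_smul]⟩
    exact this hb

end ChangeOfRings

theorem theorem4p8 {A B : Type u} [CommRing A] [CommRing B] [IsNoetherianRing A]
    [IsNoetherianRing B] (φ : A →+* B) (hφ : φ.Finite) (a : Ideal A)
    (S : ObjectProperty (ModuleCat.{u} A)) (T : ObjectProperty (ModuleCat.{u} B))
    [S.IsSerreClass] [T.IsSerreClass]
    (hST : ∀ Y : ModuleCat.{u} B, T Y ↔ S ((ModuleCat.restrictScalars.{u} φ).obj Y))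
    (X : ModuleCat.{u} B) :
    IsSerreCofinite T (a.map φ) X ↔
      IsSerreCofinite S a ((ModuleCat.restrictScalars.{u} φ).obj X) := by
  algebraize_only [φ]
  let : Module A X := Module.compHom X φ
  have : IsScalarTower A B X := .of_algebraMap_smul fun _ _ ↦ rfl
  have hsupp := Module.support_subset_zeroLocus_map_iff (A := A) (B := B) X (a := a)
  have hext := ObjectProperty.ext_quotient_iff hST X a
  exact and_congr hsupp hext
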